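/- Let $R$ be a commutative ring with $m$ commuting derivations $\partial_1,\dots,\partial_m$ and an action of a discrete group $\Gamma$ by automorphisms $\hat g$ commuting with the $\partial_l$. For $s=(g,\sigma)\in\Gamma\times\mathbb Z_+^m$ put $D^s=\hat g\,\partial^\sigma$ and $(D^s)^\dagger=(-\partial)^\sigma\hat g^{-1}$. On every extension of $R$ (a commutative ring containing $R$ with extended derivations and $\Gamma$-action) write $a\sim b$ if $a-b\in\sum_l\mathrm{Im}\,\partial_l+\sum_{g}\mathrm{Im}(\hat g-\hat e)$, and $\langle a,b\rangle=\sum_i a_ib_i$. A (bilinear) differential operator is a matrix of finite sums of terms $c\,D^s(\cdot)$ (resp. $c\,D^s(\cdot)D^t(\cdot)$) with $c\in R$; it acts on vectors over every extension of $R$. Let $\mathcal G=R^N$ be a Lie algebra whose bracket is a bilinear differential operator, let $V=R^n$, and let $\chi$ be a representation of $\mathcal G$ on $V$ such that $X.v=\chi(X)(v)$ is a bilinear differential operator (the antisymmetry and Jacobi identities of $\mathcal G$ and $\chi([X,Y])=[\chi(X),\chi(Y)]$ hold over every extension of $R$). With $\mathcal G^*=R^N$, $V^*=R^n$, define, by formal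 adjoints, $$\langle X^{\cdot}u,Y\rangle\sim-\langle u,[X,Y]\rangle,\qquad \langle X^{\cdot}v^*,v\rangle\sim-\langle v^*,X.v\rangle,\qquad \langle v\nabla v^*,X\rangle\sim\langle v^*,X.v\rangle .$$ Let $\mathcal O:\mathcal G^*\to\mathcal G$ be an $\mathcal O$-operator: a differential operator such that, over every extension of $R$, $\langle u,\mathcal O(v)\rangle\sim-\langle v,\mathcal O(u)\rangle$ and $\mathcal O(\mathcal O(u)^{\cdot}v-\mathcal O(v)^{\cdot}u)=[\mathcal O(u),\mathcal O(v)]$. For a ring $C=R[q_i^{(s)}]$ with $D^s(q_i)=q_i^{(s)}$, set $\delta H/\delta q_i=\sum_s(D^s)^\dagger(\partial H/\partial q_i^{(s)})$; an operator $B$ on vectors over $C$ defines the bracket $\{H,F\}=X_H(F)$, where $X_H$ is the $R$-linear derivation of $C$ with $X_H(q_i^{(s)})=D^s\big(B(\delta H/\delta\mathbf q)_i\big)$. On $\mathrm{Fun}(\mathcal G^*)=R[u_i^{(s)}]$ take $B(\mathbf Y)=\mathcal O(\mathbf Y^{\cdot}\mathbf u)^{\cdot}\mathbf u$. On $\mathrm{Fun}(V\oplus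 V^*)=R[x_\alpha^{(s)},p_\alpha^{(s)}]$ take $B=\begin{pmatrix}B_{xx}&B_{xp}\\B_{px}&B_{pp}\end{pmatrix}$ with $$B_{xx}(M)=-\mathcal O(\mathbf x\nabla M).\mathbf x,\quad B_{xp}(M)=\mathcal O(M\nabla\mathbf p).\mathbf x,\quad B_{px}(M)=-\mathcal O(\mathbf x\nabla M)^{\cdot}\mathbf p,\quad B_{pp}(M)=\mathcal O(M\nabla\mathbf p)^{\cdot}\mathbf p .$$ Then: 1. On $\mathrm{Fun}(\mathcal G^*)$, $\{H,F\}\sim\langle\frac{\delta H}{\delta\mathbf u}{}^{\cdot}\mathbf u,\ \mathcal O(\frac{\delta F}{\delta\mathbf u}{}^{\cdot}\mathbf u)\rangle$ for all $H,F$. 2. On $\mathrm{Fun}(V\oplus V^*)$, with $\mathbf q=(\mathbf x,\mathbf p)$, $\{H,F\}\sim\langle\frac{\delta F}{\delta\mathbf q},B(\frac{\delta H}{\delta\mathbf q})\rangle$ and $\{H,F\}\sim-\{F,H\}$ for all $H,F$; and for all vectors $M,M'$ of length $n$ over $\mathrm{Fun}(V\oplus V^*)$, $$\begin{aligned}\langle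 M',B_{xx}(M)\rangle&\sim\langle\mathbf x\nabla M,\mathcal O(\mathbf x\nabla M')\rangle,&\langle M',B_{xp}(M)\rangle&\sim-\langle M\nabla\mathbf p,\mathcal O(\mathbf x\nabla M')\rangle,\\ \langle M',B_{px}(M)\rangle&\sim-\langle\mathbf x\nabla M,\mathcal O(M'\nabla\mathbf p)\rangle,&\langle M',B_{pp}(M)\rangle&\sim\langle M\nabla\mathbf p,\mathcal O(M'\nabla\mathbf p)\rangle.\end{aligned}$$ 3. The homomorphism $\Phi:\mathrm{Fun}(\mathcal G^*)\to\mathrm{Fun}(V\oplus V^*)$ over $R$ commuting with the $\partial_l$ and $\hat g$ and given by $\Phi(\mathbf u)=\mathbf x\nabla\mathbf p$ is Hamiltonian: $\Phi(\{H,F\})=\{\Phi(H),\Phi(F)\}$ for all $H,F\in\mathrm{Fun}(\mathcal G^*)$. -/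

import Mathlib

open MvPolynomial

universe u

noncomputable section

namespace Clebsch

/-! ## Differential-difference rings -/

/-- A commutative ring with `m` commuting derivations and an action of a discrete group `Γ` by
ring automorphisms commuting with the derivations.  (For trivial `Γ` this is a differential ring
with `m` commuting derivations; for trivial `Γ` and `m = 0` it is just a commutative ring.) -/
class DDRing (m : ℕ) (Γ : Type*) [Group Γ] (A : Type*) [CommRing A] where
  der : Fin m → Derivation ℤ A A
  act : Γ →* (A →+* A)
  der_comm : ∀ i j a, der i (der j a) = der j (der i a)
  act_der : ∀ g i a, act g (der i a) = der i (act g a)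

/-- `K ⊇ R` is an extension of differential-difference rings. -/
class DDExt (m : ℕ) (Γ : Type*) [Group Γ] (R K : Type*) [CommRing R] [CommRing K]
    [DDRing m Γ R] [DDRing m Γ K] [Algebra R K] : Prop where
  injective : Function.Injective (algebraMap R K)
  der_algebraMap : ∀ (l : Fin m) (r : R),
    (DDRing.der Γ l : Derivation ℤ K K) (algebraMap R K r)
      = algebraMap R K ((DDRing.der Γ l : Derivation ℤ R R) r)
  act_algebraMap : ∀ (g : Γ) (r : R),
    (DDRing.act m g : K →+* K) (algebraMap R K r)
      = algebraMap R K ((DDRing.act m g : R →+* R) r)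

/-- Indices `(g, σ)` of the operators `ĝ ∂^σ`. -/
abbrev Idx (m : ℕ) (Γ : Type*) : Type _ := Γ × (Fin m → ℕ)

section Operators

variable {m : ℕ} {Γ : Type*} [Group Γ] {A : Type*} [CommRing A] [DDRing m Γ A]

variable (Γ A) in
/-- The derivation `∂_l` as an additive endomorphism. -/
def derEnd (l : Fin m) : Module.End ℤ A := (DDRing.der Γ l : Derivation ℤ A A).toLinearMap

variable (m A) in
/-- The automorphism `ĝ` as an additive endomorphism. -/
def actEnd (g : Γ) : Module.End ℤ A :=
  ((DDRing.act m g : A →+* A) : A →+ A).toIntLinearMap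

theorem derEnd_apply (l : Fin m) (a : A) :
    derEnd Γ A l a = (DDRing.der Γ l : Derivation ℤ A A) a := rfl

theorem actEnd_apply (g : Γ) (a : A) :
    actEnd m A g a = (DDRing.act m g : A →+* A) a := rfl

theorem derEnd_commute (i j : Fin m) : Commute (derEnd Γ A i) (derEnd Γ A j) :=
  LinearMap.ext fun a => DDRing.der_comm i j a

variable (Γ A) in
/-- `∂^σ = ∂_1^{σ_1} ⋯ ∂_m^{σ_m}`. -/
def derPow (σ : Fin m → ℕ) : Module.End ℤ A :=
  Finset.univ.noncommProd (fun l => derEnd Γ A l ^ σ l)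
    fun i _ j _ _ => (derEnd_commute i j).pow_pow _ _

/-- `D^s = ĝ ∂^σ` for `s = (g, σ)`. -/
def Dop (s : Idx m Γ) : Module.End ℤ A := actEnd m A s.1 * derPow Γ A s.2

/-- The formal adjoint `(ĝ ∂^σ)^† = (-∂)^σ ĝ⁻¹`. -/
def DopAdj (s : Idx m Γ) : Module.End ℤ A :=
  (-1 : ℤ) ^ (∑ l, s.2 l) • (derPow Γ A s.2 * actEnd m A s.1⁻¹)

variable (m Γ A) in
/-- The subgroup `∑_l Im ∂_l + ∑_g Im (ĝ - ê)` of trivial elements. -/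
def trivialElts : AddSubgroup A :=
  (⨆ l : Fin m, (derEnd Γ A l).toAddMonoidHom.range) ⊔
    ⨆ g : Γ, (actEnd m A g - 1).toAddMonoidHom.range

variable (m Γ) in
/-- `a ∼ b`: equality modulo `∑_l Im ∂_l + ∑_g Im (ĝ - ê)`. -/
def Sim (a b : A) : Prop := a - b ∈ trivialElts m Γ A

theorem derPow_zero : derPow Γ A (0 : Fin m → ℕ) = 1 := by
  simp only [derPow, Pi.zero_apply, pow_zero]
  exact Finset.noncommProd_eq_pow_card _ _ _ 1 (fun _ _ => rfl) |>.trans (one_pow _)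

theorem derPow_add_single (σ : Fin m → ℕ) (l : Fin m) :
    derPow Γ A (σ + Pi.single l 1) = derEnd Γ A l * derPow Γ A σ := by
  classical
  have h : ∀ ρ : Fin m → ℕ, derPow Γ A ρ = derEnd Γ A l ^ ρ l *
      (Finset.univ.erase l).noncommProd (fun k => derEnd Γ A k ^ ρ k)
        (fun i _ j _ _ => (derEnd_commute i j).pow_pow _ _) := fun ρ =>
    (Finset.mul_noncommProd_erase Finset.univ (Finset.mem_univ l) _ _).symm
  rw [h, h σ, ← mul_assoc, ← pow_succ']
  congr 1
  · simp
  · refine Finset.noncommProd_congr rfl (fun k hk => ?_) _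
    simp [Pi.single_eq_of_ne (Finset.ne_of_mem_erase hk)]

theorem multiIndex_induction {P : (Fin m → ℕ) → Prop} (zero : P 0)
    (succ : ∀ σ l, P σ → P (σ + Pi.single l 1)) (σ : Fin m → ℕ) : P σ := by
  induction hk : ∑ l, σ l generalizing σ with
  | zero =>
    have : σ = 0 := funext fun l => (Finset.sum_eq_zero_iff.1 hk) l (Finset.mem_univ l)
    exact this ▸ zero
  | succ k ih =>
    obtain ⟨l, -, hl⟩ : ∃ l ∈ Finset.univ, σ l ≠ 0 := by
      by_contra! h
      rw [Finset.sum_eq_zero h] at hk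
      omega
    have hσ : σ = (σ - Pi.single l 1) + Pi.single l 1 := by
      funext j
      by_cases hj : j = l
      · subst hj; simp; omega
      · simp [hj]
    rw [hσ]
    refine succ _ _ (ih _ ?_)
    rw [hσ] at hk
    simp only [Pi.add_apply, Finset.sum_add_distrib] at hk
    simpa using hk

protected theorem Sim.refl (a : A) : Sim m Γ a a := by simp [Sim, zero_mem]

protected theorem Sim.trans {a b c : A} (h : Sim m Γ a b) (h' : Sim m Γ b c) : Sim m Γ a c := by
  simpa [Sim] using add_mem h h'

protected theorem Sim.add {a b c d : A} (h : Sim m Γ a b) (h' : Sim m Γ c d) :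
    Sim m Γ (a + c) (b + d) := by
  simpa [Sim, add_sub_add_comm] using add_mem h h'

protected theorem Sim.zsmul {a b : A} (h : Sim m Γ a b) (k : ℤ) : Sim m Γ (k • a) (k • b) := by
  simpa only [Sim, ← smul_sub] using zsmul_mem h k

protected theorem Sim.sum {ι : Type*} {s : Finset ι} {f g : ι → A} (h : ∀ i ∈ s, Sim m Γ (f i) (g i)) :
    Sim m Γ (∑ i ∈ s, f i) (∑ i ∈ s, g i) := by
  simpa only [Sim, ← Finset.sum_sub_distrib] using sum_mem h

theorem sim_der (l : Fin m) (f g : A) :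
    Sim m Γ (f * derEnd Γ A l g) (-(derEnd Γ A l f * g)) := by
  refine AddSubgroup.mem_sup_left (AddSubgroup.mem_iSup_of_mem l ⟨f * g, ?_⟩)
  change (DDRing.der Γ l : Derivation ℤ A A) (f * g) = _
  simp only [derEnd_apply, Derivation.leibniz, smul_eq_mul]
  ring

theorem sim_act (h : Γ) (f g : A) :
    Sim m Γ (f * actEnd m A h g) (actEnd m A h⁻¹ f * g) := by
  refine AddSubgroup.mem_sup_right
    (AddSubgroup.mem_iSup_of_mem h ⟨actEnd m A h⁻¹ f * g, ?_⟩)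
  change (DDRing.act m h : A →+* A) ((DDRing.act m h⁻¹ : A →+* A) f * g)
    - (DDRing.act m h⁻¹ : A →+* A) f * g = _
  have : (DDRing.act m h : A →+* A) ((DDRing.act m h⁻¹ : A →+* A) f) = f := by
    rw [← RingHom.comp_apply, ← RingHom.mul_def, ← map_mul, mul_inv_cancel, map_one]
    rfl
  rw [map_mul, this]
  rfl

/-- Integration by parts: `f D^s(g) ∼ (D^s)^†(f) g`. -/
theorem sim_Dop (s : Idx m Γ) (f g : A) : Sim m Γ (f * Dop s g) (DopAdj s f * g) := by
  obtain ⟨h, σ⟩ := s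
  refine (sim_act h f _).trans ?_
  simp only [DopAdj, LinearMap.smul_apply, Module.End.mul_apply, smul_mul_assoc]
  generalize actEnd m A h⁻¹ f = f'
  induction σ using multiIndex_induction generalizing f' with
  | zero => simpa [derPow_zero] using Sim.refl (m := m) (Γ := Γ) (f' * g)
  | succ σ l ih =>
    have e : ∑ k, (σ + Pi.single l 1 : Fin m → ℕ) k = (∑ k, σ k) + 1 := by
      simp [Finset.sum_add_distrib]
    have hc : derEnd Γ A l * derPow Γ A σ = derPow Γ A σ * derEnd Γ A l :=
      Finset.noncommProd_commute _ _ _ _ fun j _ => (derEnd_commute l j).pow_right _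
    rw [derPow_add_single, e, Module.End.mul_apply]
    refine (sim_der l f' _).trans ?_
    have := (ih (derEnd Γ A l f')).zsmul (-1)
    rw [hc, Module.End.mul_apply, pow_succ, mul_comm ((-1 : ℤ) ^ _), mul_smul]
    simpa using this

end Operators

/-- `⟨x, y⟩ = x^t y`. -/
def pairing {ι A : Type*} [Fintype ι] [CommRing A] (x y : ι → A) : A := ∑ i, x i * y i

/-! ## Matrix (bi)differential operators with coefficients in `R`, acting on every extension -/

/-- Matrix differential operators `R^ι → R^κ`, given by their coefficients:
`A(x)_k = ∑_{i,s} A_{k i s} D^s(x_i)`. -/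
abbrev LinOp (m : ℕ) (Γ ι κ R : Type*) [Zero R] := κ → ι → (Idx m Γ →₀ R)

/-- Bilinear matrix differential operators `R^ι × R^ι' → R^κ`:
`β(x, y)_k = ∑_{i,j,s,t} β_{k i j s t} D^s(x_i) D^t(y_j)`. -/
abbrev BiOp (m : ℕ) (Γ ι ι' κ R : Type*) [Zero R] := κ → ι → ι' → (Idx m Γ × Idx m Γ →₀ R)

section Apply

variable {m : ℕ} {Γ : Type*} [Group Γ] {ι ι' κ : Type*} [Fintype ι] [Fintype ι'] [Fintype κ]
  {R : Type*} [CommRing R] {K : Type*} [CommRing K] [DDRing m Γ K] [Algebra R K]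

/-- The action of a matrix differential operator on vectors over an extension. -/
def LinOp.app (T : LinOp m Γ ι κ R) (x : ι → K) : κ → K := fun k =>
  ∑ i, (T k i).sum fun s c => c • Dop s (x i)

/-- The action of a bilinear differential operator on vectors over an extension. -/
def BiOp.app (β : BiOp m Γ ι ι' κ R) (x : ι → K) (y : ι' → K) : κ → K := fun k =>
  ∑ i, ∑ j, (β k i j).sum fun st c => c • (Dop st.1 (x i) * Dop st.2 (y j))

/-- The formal adjoint of `β` in its first argument: `⟨w, β(x, y)⟩ ∼ ⟨adjFst y w, x⟩`. -/
def BiOp.adjFst (β : BiOp m Γ ι ι' κ R) (y : ι' → K) (w : κ → K) : ι → K := fun i =>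
  ∑ k, ∑ j, (β k i j).sum fun st c => DopAdj st.1 (c • (Dop st.2 (y j) * w k))

/-- The formal adjoint of `β` in its second argument: `⟨w, β(x, y)⟩ ∼ ⟨adjSnd x w, y⟩`. -/
def BiOp.adjSnd (β : BiOp m Γ ι ι' κ R) (x : ι → K) (w : κ → K) : ι' → K := fun j =>
  ∑ k, ∑ i, (β k i j).sum fun st c => DopAdj st.2 (c • (Dop st.1 (x i) * w k))

theorem BiOp.sim_adjFst (β : BiOp m Γ ι ι' κ R) (x : ι → K) (y : ι' → K) (w : κ → K) :
    Sim m Γ (pairing w (β.app x y)) (pairing (β.adjFst y w) x) := by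
  simp only [pairing, BiOp.app, BiOp.adjFst, Finset.mul_sum, Finset.sum_mul, Finsupp.sum]
  conv_rhs => rw [Finset.sum_comm]
  refine Sim.sum fun k _ => Sim.sum fun i _ => Sim.sum fun j _ => Sim.sum fun st _ => ?_
  convert sim_Dop st.1 ((β k i j st) • (Dop st.2 (y j) * w k)) (x i) using 1
  simp only [Algebra.smul_def]
  ring

theorem BiOp.sim_adjSnd (β : BiOp m Γ ι ι' κ R) (x : ι → K) (y : ι' → K) (w : κ → K) :
    Sim m Γ (pairing w (β.app x y)) (pairing (β.adjSnd x w) y) := by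
  simp only [pairing, BiOp.app, BiOp.adjSnd, Finset.mul_sum, Finset.sum_mul, Finsupp.sum]
  conv_rhs => rw [Finset.sum_comm]
  refine Sim.sum fun k _ => ?_
  conv_rhs => rw [Finset.sum_comm]
  refine Sim.sum fun i _ => Sim.sum fun j _ => Sim.sum fun st _ => ?_
  convert sim_Dop st.2 ((β k i j st) • (Dop st.1 (x i) * w k)) (y j) using 1
  simp only [Algebra.smul_def]
  ring

end Apply

/-! ## Differential-difference Lie algebras, representations, `𝒪`-operators -/

section Structures

variable (m : ℕ) (Γ : Type u) [Group Γ] (R : Type u) [CommRing R] [DDRing m Γ R]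

/-- A Lie algebra structure on `R^N` whose bracket is a bilinear differential operator; the
axioms hold over every extension of `R`. -/
structure DDLieAlgebra (N : ℕ) where
  bracket : BiOp m Γ (Fin N) (Fin N) (Fin N) R
  skew : ∀ (K : Type u) [CommRing K] [DDRing m Γ K] [Algebra R K] [DDExt m Γ R K]
    (x y : Fin N → K), bracket.app x y = - bracket.app y x
  jacobi : ∀ (K : Type u) [CommRing K] [DDRing m Γ K] [Algebra R K] [DDExt m Γ R K]
    (x y z : Fin N → K),
    bracket.app (bracket.app x y) z + bracket.app (bracket.app y z) x
      + bracket.app (bracket.app z x) y = 0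

variable {m Γ R}

namespace DDLieAlgebra

variable {N : ℕ} (L : DDLieAlgebra m Γ R N)
  {K : Type u} [CommRing K] [DDRing m Γ K] [Algebra R K]

/-- The coadjoint action `X˙u` of `𝒢` on `𝒢^*`: `⟨X˙u, Y⟩ ∼ -⟨u, [X, Y]⟩`. -/
def coad (X u : Fin N → K) : Fin N → K := - L.bracket.adjSnd X u

/-- A representation `χ : 𝒢 → Diff(V)`, `V = R^n`: `χ(X)(v)` is a bilinear differential operator
in `X` and `v`, and `χ([X, Y]) = [χ(X), χ(Y)]` over every extension of `R`. -/
structure Rep (n : ℕ) where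
  action : BiOp m Γ (Fin N) (Fin n) (Fin n) R
  map_lie : ∀ (K : Type u) [CommRing K] [DDRing m Γ K] [Algebra R K] [DDExt m Γ R K]
    (X Y : Fin N → K) (v : Fin n → K),
    action.app (L.bracket.app X Y) v
      = action.app X (action.app Y v) - action.app Y (action.app X v)

/-- A (skewsymmetric) `𝒪`-operator `𝒢^* → 𝒢`. -/
structure OOperator where
  op : LinOp m Γ (Fin N) (Fin N) R
  skew : ∀ (K : Type u) [CommRing K] [DDRing m Γ K] [Algebra R K] [DDExt m Γ R K]
    (u v : Fin N → K), Sim m Γ (pairing u (op.app v)) (- pairing v (op.app u))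
  map_lie : ∀ (K : Type u) [CommRing K] [DDRing m Γ K] [Algebra R K] [DDExt m Γ R K]
    (u v : Fin N → K),
    op.app (L.coad (op.app u) v - L.coad (op.app v) u) = L.bracket.app (op.app u) (op.app v)

variable {L} {n : ℕ} (χ : L.Rep n)

/-- `X.v = χ(X)(v)`. -/
def Rep.smul (X : Fin N → K) (v : Fin n → K) : Fin n → K := χ.action.app X v

/-- The dual action `X˙v^* = -χ(X)^†(v^*)`: `⟨X˙v^*, v⟩ ∼ -⟨v^*, X.v⟩`. -/
def Rep.dual (X : Fin N → K) (v' : Fin n → K) : Fin n → K := - χ.action.adjSnd X v'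

/-- The map `∇ : V × V^* → 𝒢^*`: `⟨v ∇ v^*, X⟩ ∼ ⟨v^*, X.v⟩`. -/
def Rep.nabla (v v' : Fin n → K) : Fin N → K := χ.action.adjFst v v'

theorem sim_coad (X u Y : Fin N → K) :
    Sim m Γ (pairing (L.coad X u) Y) (- pairing u (L.bracket.app X Y)) := by
  have h := L.bracket.sim_adjSnd X Y u
  unfold Sim at h ⊢
  convert h using 1
  simp only [coad, pairing, Pi.neg_apply, neg_mul, Finset.sum_neg_distrib]
  ring

theorem Rep.sim_dual (X : Fin N → K) (v v' : Fin n → K) :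
    Sim m Γ (pairing (χ.dual X v') v) (- pairing v' (χ.smul X v)) := by
  have h := χ.action.sim_adjSnd X v v'
  unfold Sim at h ⊢
  convert h using 1
  simp only [Rep.dual, Rep.smul, pairing, Pi.neg_apply, neg_mul, Finset.sum_neg_distrib]
  ring

theorem Rep.sim_nabla (v v' : Fin n → K) (X : Fin N → K) :
    Sim m Γ (pairing (χ.nabla v v') X) (pairing v' (χ.smul X v)) := by
  have h := neg_mem (χ.action.sim_adjFst X v v')
  simpa [Sim, Rep.nabla, Rep.smul] using h

end DDLieAlgebra

end Structures

/-! ## Rings of differential functions `R[q_i^{(g|σ)}]` -/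

/-- The ring `R[q_i^{(g|σ)}]`, `i ∈ κ`, `g ∈ Γ`, `σ ∈ ℤ_+^m`. -/
abbrev Jet (m : ℕ) (Γ κ R : Type*) [CommRing R] := MvPolynomial (κ × Idx m Γ) R

section CoeffDer

variable {τ R : Type*} [CommRing R]

/-- A derivation of `R` applied to the coefficients of a polynomial. -/
def coeffDer (d : Derivation ℤ R R) : Derivation ℤ (MvPolynomial τ R) (MvPolynomial τ R) :=
  Derivation.mk'
    (AddMonoidHom.mk' (fun p : MvPolynomial τ R => (AddMonoidAlgebra.ofCoeff
        ((AddMonoidAlgebra.coeff p).mapRange d (map_zero d)) : MvPolynomial τ R))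
      (fun p q => by ext v; simp [MvPolynomial.coeff])).toIntLinearMap
    (fun p q => by
      have hm : ∀ (v : τ →₀ ℕ) (a : R), (AddMonoidAlgebra.ofCoeff
          ((AddMonoidAlgebra.coeff (monomial v a)).mapRange d (map_zero d)) : MvPolynomial τ R)
          = monomial v (d a) := fun v a => by
        classical
        ext w
        change d (coeff w (monomial v a)) = coeff w (monomial v (d a))
        simp only [coeff_monomial]
        split_ifs <;> simp
      have ha : ∀ p q : MvPolynomial τ R, (AddMonoidAlgebra.ofCoeff
          ((AddMonoidAlgebra.coeff (p + q)).mapRange d (map_zero d)) : MvPolynomial τ R)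
          = AddMonoidAlgebra.ofCoeff ((AddMonoidAlgebra.coeff p).mapRange d (map_zero d))
            + AddMonoidAlgebra.ofCoeff ((AddMonoidAlgebra.coeff q).mapRange d (map_zero d)) :=
        fun p q => by ext v; simp [MvPolynomial.coeff]
      simp only [AddMonoidHom.coe_toIntLinearMap, AddMonoidHom.mk'_apply]
      induction p using MvPolynomial.induction_on' with
      | add p₁ p₂ h₁ h₂ => rw [add_mul, ha, h₁, h₂, ha]; simp only [smul_eq_mul]; ring
      | monomial v a =>
        induction q using MvPolynomial.induction_on' with
        | add q₁ q₂ h₁ h₂ => rw [mul_add, ha, h₁, h₂, ha]; simp only [smul_eq_mul]; ring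
        | monomial w b =>
          rw [monomial_mul, hm, hm, hm]
          simp only [smul_eq_mul, monomial_mul, Derivation.leibniz, map_add]
          rw [add_comm w v, mul_comm])

theorem coeffDer_coeff (d : Derivation ℤ R R) (p : MvPolynomial τ R) (v : τ →₀ ℕ) :
    coeff v (coeffDer d p) = d (coeff v p) := rfl

theorem coeffDer_C (d : Derivation ℤ R R) (r : R) :
    coeffDer d (C r : MvPolynomial τ R) = C (d r) := by
  classical
  ext v
  simp only [coeffDer_coeff, coeff_C]
  split_ifs <;> simp

theorem coeffDer_X (d : Derivation ℤ R R) (i : τ) :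
    coeffDer d (X i : MvPolynomial τ R) = 0 := by
  classical
  ext v
  simp only [coeffDer_coeff, coeff_X, coeff_zero]
  split_ifs <;> simp

end CoeffDer

section JetRing

variable {m : ℕ} {Γ : Type*} [Group Γ] {κ : Type*} {R : Type*} [CommRing R] [DDRing m Γ R]

/-- The total derivative: `∂_l` on coefficients, `∂_l q_i^{(g|σ)} = q_i^{(g|σ + e_l)}`. -/
def jetDer (l : Fin m) : Derivation ℤ (Jet m Γ κ R) (Jet m Γ κ R) :=
  coeffDer (DDRing.der Γ l) +
    (mkDerivation R fun v : κ × Idx m Γ =>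
      (X (v.1, (v.2.1, v.2.2 + Pi.single l 1)) : Jet m Γ κ R)).restrictScalars ℤ

/-- The group action: `ĝ` on coefficients, `ĝ q_i^{(h|σ)} = q_i^{(gh|σ)}`. -/
def jetAct (g : Γ) : Jet m Γ κ R →+* Jet m Γ κ R :=
  eval₂Hom (C.comp (DDRing.act m g : R →+* R)) fun v => X (v.1, (g * v.2.1, v.2.2))

theorem jetDer_C (l : Fin m) (r : R) :
    (jetDer l : Derivation ℤ (Jet m Γ κ R) _) (C r) = C ((DDRing.der Γ l : Derivation ℤ R R) r) := by
  simp [jetDer, coeffDer_C]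

theorem jetDer_X (l : Fin m) (v : κ × Idx m Γ) :
    (jetDer l : Derivation ℤ (Jet m Γ κ R) _) (X v)
      = X (v.1, (v.2.1, v.2.2 + Pi.single l 1)) := by
  simp [jetDer, coeffDer_X, mkDerivation_X]

theorem jetAct_C (g : Γ) (r : R) :
    (jetAct g : Jet m Γ κ R →+* _) (C r) = C ((DDRing.act m g : R →+* R) r) := by
  simp [jetAct]

theorem jetAct_X (g : Γ) (v : κ × Idx m Γ) :
    (jetAct g : Jet m Γ κ R →+* Jet m Γ κ R) (X v) = X (v.1, (g * v.2.1, v.2.2)) := by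
  simp [jetAct]

instance jetDDRing : DDRing m Γ (Jet m Γ κ R) where
  der := jetDer
  act :=
    { toFun := jetAct
      map_one' := by
        refine MvPolynomial.ringHom_ext (fun r => ?_) fun v => ?_
        · rw [jetAct_C]; simp
        · rw [jetAct_X]; simp
      map_mul' := fun g h => by
        refine MvPolynomial.ringHom_ext (fun r => ?_) fun v => ?_
        · simp [jetAct_C]
        · simp [jetAct_X, mul_assoc] }
  der_comm := fun i j p => by
    change jetDer i (jetDer j p) = jetDer j (jetDer i p)
    induction p using MvPolynomial.induction_on with
    | C r => simp only [jetDer_C, DDRing.der_comm i j]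
    | add p q hp hq => simp only [map_add, hp, hq]
    | mul_X p v hp =>
      simp only [Derivation.leibniz, map_add, hp, jetDer_X, smul_eq_mul,
        add_right_comm _ (Pi.single i 1 : Fin m → ℕ)]
      ring
  act_der := fun g i p => by
    change jetAct g (jetDer i p) = jetDer i (jetAct g p)
    induction p using MvPolynomial.induction_on with
    | C r => simp only [jetDer_C, jetAct_C, DDRing.act_der]
    | add p q hp hq => simp only [map_add, hp, hq]
    | mul_X p v hp =>
      simp only [Derivation.leibniz, map_add, map_mul, hp, jetDer_X, jetAct_X, smul_eq_mul]

instance jetDDExt : DDExt m Γ R (Jet m Γ κ R) where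
  injective := C_injective _ _
  der_algebraMap := fun l r => jetDer_C l r
  act_algebraMap := fun g r => jetAct_C g r

/-- The generator `q_i = q_i^{(e|0)}`. -/
def gen (i : κ) : Jet m Γ κ R := X (i, ((1 : Γ), (0 : Fin m → ℕ)))

/-- The variational derivative `δH/δq_i = ∑_s (D^s)^† (∂H/∂q_i^{(s)})`
(a sum with finitely many nonzero terms). -/
def varDer (H : Jet m Γ κ R) (i : κ) : Jet m Γ κ R :=
  ∑ᶠ s : Idx m Γ, DopAdj s (pderiv (i, s) H)

/-- The evolution derivation `X` with `X(q_i^{(s)}) = D^s(w_i)`. -/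
def evol (w : κ → Jet m Γ κ R) : Derivation R (Jet m Γ κ R) (Jet m Γ κ R) :=
  mkDerivation R fun v => Dop v.2 (w v.1)

/-- The bracket `{H, F} = X_H(F)` defined by an operator `B`, where `X_H` is the evolution
derivation with `X_H(q) = B(δH/δq)`. -/
def poisson (B : (κ → Jet m Γ κ R) → (κ → Jet m Γ κ R)) (H F : Jet m Γ κ R) : Jet m Γ κ R :=
  evol (B (varDer H)) F

variable {κ' : Type*}

/-- The homomorphism of differential-difference rings over `R` with `Φ(q_i) = w_i`. -/
def jetHom (w : κ → Jet m Γ κ' R) : Jet m Γ κ R →ₐ[R] Jet m Γ κ' R :=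
  aeval fun v => Dop v.2 (w v.1)

theorem Dop_add_single {B : Type*} [CommRing B] [DDRing m Γ B] (g : Γ) (σ : Fin m → ℕ)
    (l : Fin m) (b : B) :
    Dop (g, σ + Pi.single l 1) b = (DDRing.der Γ l : Derivation ℤ B B) (Dop (g, σ) b) := by
  simp only [Dop, derPow_add_single, Module.End.mul_apply, actEnd_apply, derEnd_apply,
    DDRing.act_der]

theorem Dop_mul_left {B : Type*} [CommRing B] [DDRing m Γ B] (g h : Γ) (σ : Fin m → ℕ) (b : B) :
    Dop (g * h, σ) b = (DDRing.act m g : B →+* B) (Dop (h, σ) b) := by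
  simp only [Dop, Module.End.mul_apply, actEnd_apply, map_mul]
  rfl

theorem jetHom_gen (w : κ → Jet m Γ κ' R) (i : κ) : jetHom w (gen i) = w i := by
  simp only [jetHom, gen, aeval_X, Dop, derPow_zero, mul_one, actEnd_apply, map_one]
  rfl

theorem jetHom_der (w : κ → Jet m Γ κ' R) (l : Fin m) (f : Jet m Γ κ R) :
    jetHom w ((DDRing.der Γ l : Derivation ℤ _ _) f)
      = (DDRing.der Γ l : Derivation ℤ (Jet m Γ κ' R) _) (jetHom w f) := by
  change jetHom w (jetDer l f) = jetDer l (jetHom w f)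
  induction f using MvPolynomial.induction_on with
  | C r => rw [jetDer_C]; simp only [jetHom, algHom_C]; exact (jetDer_C l r).symm
  | add p q hp hq => simp only [map_add, hp, hq]
  | mul_X p v hp =>
    have hv : jetHom w (jetDer l (X v)) = jetDer l (jetHom w (X v)) := by
      rw [jetDer_X]
      simp only [jetHom, aeval_X, Dop_add_single]
      rfl
    simp only [Derivation.leibniz, map_add, map_mul, hp, hv, smul_eq_mul]

theorem jetHom_act (w : κ → Jet m Γ κ' R) (g : Γ) (f : Jet m Γ κ R) :
    jetHom w ((DDRing.act m g : _ →+* _) f)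
      = (DDRing.act m g : Jet m Γ κ' R →+* _) (jetHom w f) := by
  change jetHom w (jetAct g f) = jetAct g (jetHom w f)
  induction f using MvPolynomial.induction_on with
  | C r => rw [jetAct_C]; simp only [jetHom, algHom_C]; exact (jetAct_C g r).symm
  | add p q hp hq => simp only [map_add, hp, hq]
  | mul_X p v hp =>
    have hv : jetHom w (jetAct g (X v)) = jetAct g (jetHom w (X v)) := by
      rw [jetAct_X]
      simp only [jetHom, aeval_X, Dop_mul_left]
      rfl
    simp only [map_mul, hp, hv]

/-- `Φ` is Hamiltonian: `Φ({H, F}₁) = {Φ(H), Φ(F)}₂` for all `H`, `F`. -/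
def IsHamiltonian (Φ : Jet m Γ κ R →ₐ[R] Jet m Γ κ' R)
    (B₁ : (κ → Jet m Γ κ R) → (κ → Jet m Γ κ R))
    (B₂ : (κ' → Jet m Γ κ' R) → (κ' → Jet m Γ κ' R)) : Prop :=
  ∀ H F, Φ (poisson B₁ H F) = poisson B₂ (Φ H) (Φ F)

end JetRing

/-! ## The quadratic brackets and the Clebsch map -/

section Brackets

variable {m : ℕ} {Γ : Type u} [Group Γ] {R : Type u} [CommRing R] [DDRing m Γ R]
  {N n : ℕ} {L : DDLieAlgebra m Γ R N}

variable (m Γ R N) in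
/-- `Fun(𝒢^*) = R[u_i^{(g|σ)}]`. -/
abbrev FunDual := Jet m Γ (Fin N) R

variable (m Γ R n) in
/-- `Fun(V ⊕ V^*) = R[x_α^{(g|σ)}, p_α^{(g|σ)}]`. -/
abbrev FunVV := Jet m Γ (Fin n ⊕ Fin n) R

variable (m Γ R N) in
/-- The vector `u` of generators of `Fun(𝒢^*)`. -/
def uVec : Fin N → FunDual m Γ R N := gen

variable (m Γ R n) in
/-- The vector `x` of generators of `Fun(V ⊕ V^*)`. -/
def xVec : Fin n → FunVV m Γ R n := fun α => gen (Sum.inl α)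

variable (m Γ R n) in
/-- The vector `p` of generators of `Fun(V ⊕ V^*)`. -/
def pVec : Fin n → FunVV m Γ R n := fun α => gen (Sum.inr α)

/-- The Hamiltonian matrix `B(Y) = 𝒪(Y˙u)˙u` of the quadratic bracket on `𝒢^*`. -/
def quadB (O : L.OOperator) (Y : Fin N → FunDual m Γ R N) : Fin N → FunDual m Γ R N :=
  L.coad (O.op.app (L.coad Y (uVec m Γ R N))) (uVec m Γ R N)

variable (χ : L.Rep n) (O : L.OOperator)

/-- `B_xx(M) = -𝒪(x ∇ M).x`. -/
def Bxx (M : Fin n → FunVV m Γ R n) : Fin n → FunVV m Γ R n :=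
  - χ.smul (O.op.app (χ.nabla (xVec m Γ R n) M)) (xVec m Γ R n)

/-- `B_xp(M) = 𝒪(M ∇ p).x`. -/
def Bxp (M : Fin n → FunVV m Γ R n) : Fin n → FunVV m Γ R n :=
  χ.smul (O.op.app (χ.nabla M (pVec m Γ R n))) (xVec m Γ R n)

/-- `B_px(M) = -𝒪(x ∇ M)˙p`. -/
def Bpx (M : Fin n → FunVV m Γ R n) : Fin n → FunVV m Γ R n :=
  - χ.dual (O.op.app (χ.nabla (xVec m Γ R n) M)) (pVec m Γ R n)

/-- `B_pp(M) = 𝒪(M ∇ p)˙p`. -/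
def Bpp (M : Fin n → FunVV m Γ R n) : Fin n → FunVV m Γ R n :=
  χ.dual (O.op.app (χ.nabla M (pVec m Γ R n))) (pVec m Γ R n)

/-- The matrix `B = (B_xx, B_xp; B_px, B_pp)` of the quadratic bracket on `V ⊕ V^*`. -/
def clebschB (M : Fin n ⊕ Fin n → FunVV m Γ R n) : Fin n ⊕ Fin n → FunVV m Γ R n :=
  Sum.elim
    (Bxx χ O (fun α => M (Sum.inl α)) + Bxp χ O (fun α => M (Sum.inr α)))
    (Bpx χ O (fun α => M (Sum.inl α)) + Bpp χ O (fun α => M (Sum.inr α)))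

/-- The Clebsch map `Φ(u) = x ∇ p`. -/
def clebschMap : FunDual m Γ R N →ₐ[R] FunVV m Γ R n :=
  jetHom (χ.nabla (xVec m Γ R n) (pVec m Γ R n))

end Brackets

end Clebsch

end

open Clebsch

noncomputable section

namespace Clebsch

/-! ### Elementary rules for `Sim` and for the pairing. -/

section SimLemmas

variable {m : ℕ} {Γ : Type*} [Group Γ] {A : Type*} [CommRing A] [DDRing m Γ A]

/-! Put μ(M) = x∇M_x − M_p∇p (`clebschMoment`). The operator B sends M to the infinitesimal action
on (x, p) of the single Lie algebra element 𝒪(−μ(M)), and ⟨M', B(M)⟩ ∼ ⟨μ(M), 𝒪(μ(M'))⟩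
(`clebschB_eq`, `sim_pairing_clebschB`). Skewsymmetry of the bracket on V ⊕ V^* is therefore that of
𝒪.

For the Clebsch map let Y = Φ(δH/δu). The chain rule gives δΦ(H)/δ(x, p) = (−Y˙p, Y.x)
(`varDer_clebschMap`), and since ∇ is equivariant (`coad_nabla`), μ of this gradient is −Y˙(x∇p). So
X_{Φ(H)} is the action of Z = 𝒪(Y˙(x∇p)) on x and p. By the Leibniz rule and equivariance again it
moves x∇p by Z˙(x∇p), which is Φ of the velocity of u under X_H. Both Φ∘X_H and X_{Φ(H)}∘Φ are
evolution derivations along Φ, so agreement on the generators u_i makes them equal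
(`IsEvolution.unique`).

The adjoints give equivariance and the gradient formula only modulo trivial elements. To reach
equality the covectors are paired with new independent variables over the given ring; the
variational derivative kills trivial elements and reads off the coefficients
(`eq_of_sim_pairing_gen`). -/

protected theorem Sim.neg {a b : A} (h : Sim m Γ a b) : Sim m Γ (-a) (-b) := by
  simpa using h.zsmul (-1)

protected theorem Sim.symm {a b : A} (h : Sim m Γ a b) : Sim m Γ b a := by
  simpa [Sim] using neg_mem h

end SimLemmas

section Pairing

variable {ι A : Type*} [Fintype ι] [CommRing A]

theorem pairing_comm (x y : ι → A) : pairing x y = pairing y x :=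
  Finset.sum_congr rfl fun _ _ => mul_comm _ _

theorem pairing_neg_left (x y : ι → A) : pairing (-x) y = -pairing x y := by
  simp [pairing]

theorem pairing_neg_right (x y : ι → A) : pairing x (-y) = -pairing x y := by
  simp [pairing]

theorem pairing_add_left (x x' y : ι → A) :
    pairing (x + x') y = pairing x y + pairing x' y := by
  simp [pairing, add_mul, Finset.sum_add_distrib]

theorem pairing_add_right (x y y' : ι → A) :
    pairing x (y + y') = pairing x y + pairing x y' := by
  simp [pairing, mul_add, Finset.sum_add_distrib]

theorem pairing_sub_right (x y y' : ι → A) :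
    pairing x (y - y') = pairing x y - pairing x y' := by
  rw [sub_eq_add_neg, pairing_add_right, pairing_neg_right, ← sub_eq_add_neg]

theorem pairing_sumElim {ι' : Type*} [Fintype ι'] (x y : ι ⊕ ι' → A) :
    pairing x y = pairing (x ∘ Sum.inl) (y ∘ Sum.inl) + pairing (x ∘ Sum.inr) (y ∘ Sum.inr) := by
  simp [pairing]

end Pairing

/-! ## Maps commuting with the operators `D^s` -/

section Commuting

variable {m : ℕ} {Γ : Type*} [Group Γ] {A B : Type*} [CommRing A] [DDRing m Γ A]
  [CommRing B] [DDRing m Γ B]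

variable (m Γ) in
/-- An additive map commuting with the derivations and with the group action. -/
structure IsDDMap (f : A →+ B) : Prop where
  map_der : ∀ (l : Fin m) a, f ((DDRing.der Γ l : Derivation ℤ A A) a)
    = (DDRing.der Γ l : Derivation ℤ B B) (f a)
  map_act : ∀ (g : Γ) a, f ((DDRing.act m g : A →+* A) a) = (DDRing.act m g : B →+* B) (f a)

variable {f : A →+ B}

theorem IsDDMap.map_derPow (hf : IsDDMap m Γ f) (σ : Fin m → ℕ) (a : A) :
    f (derPow Γ A σ a) = derPow Γ B σ (f a) := by
  induction σ using multiIndex_induction with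
  | zero => simp [derPow_zero]
  | succ σ l ih =>
    rw [derPow_add_single, derPow_add_single, Module.End.mul_apply, Module.End.mul_apply, ← ih]
    exact hf.map_der l _

theorem IsDDMap.map_Dop (hf : IsDDMap m Γ f) (s : Idx m Γ) (a : A) :
    f (Dop s a) = Dop s (f a) := by
  rw [Dop, Dop, Module.End.mul_apply, Module.End.mul_apply, ← hf.map_derPow]
  exact hf.map_act _ _

theorem IsDDMap.map_DopAdj (hf : IsDDMap m Γ f) (s : Idx m Γ) (a : A) :
    f (DopAdj s a) = DopAdj s (f a) := by
  rw [DopAdj, DopAdj, LinearMap.smul_apply, LinearMap.smul_apply, map_zsmul,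
    Module.End.mul_apply, Module.End.mul_apply, hf.map_derPow]
  congr 2
  exact hf.map_act _ _

variable (m Γ) in
/-- `D` is an `R`-linear derivation along the homomorphism `φ`, and both commute with the
derivations and with the group action. -/
structure IsDDDerivation {R : Type*} [CommRing R] [Algebra R A] [Algebra R B]
    (φ : A →ₐ[R] B) (D : A →ₗ[R] B) : Prop where
  hom : IsDDMap m Γ (φ : A →+ B)
  der : IsDDMap m Γ (D : A →+ B)
  leibniz : ∀ a b, D (a * b) = φ a * D b + D a * φ b

section Ops

variable {ι ι' κ : Type*}
  {R : Type*} [CommRing R] [Algebra R A] [Algebra R B]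

theorem LinOp.map_app [Fintype ι]
    (T : LinOp m Γ ι κ R) {φ : A →ₐ[R] B} (hφ : IsDDMap m Γ (φ : A →+ B))
    (x : ι → A) : φ ∘ T.app x = T.app (φ ∘ x) := by
  funext k
  simp only [Function.comp_apply, LinOp.app, Finsupp.sum, map_sum, map_smul]
  simp only [show ∀ (s : Idx m Γ) a, φ (Dop s a) = Dop s (φ a) from hφ.map_Dop]

theorem BiOp.map_app [Fintype ι] [Fintype ι']
    (β : BiOp m Γ ι ι' κ R) {φ : A →ₐ[R] B} (hφ : IsDDMap m Γ (φ : A →+ B))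
    (x : ι → A) (y : ι' → A) : φ ∘ β.app x y = β.app (φ ∘ x) (φ ∘ y) := by
  funext k
  simp only [Function.comp_apply, BiOp.app, Finsupp.sum, map_sum, map_smul, map_mul]
  simp only [show ∀ (s : Idx m Γ) a, φ (Dop s a) = Dop s (φ a) from hφ.map_Dop]

theorem BiOp.map_adjFst [Fintype ι'] [Fintype κ]
    (β : BiOp m Γ ι ι' κ R) {φ : A →ₐ[R] B}
    (hφ : IsDDMap m Γ (φ : A →+ B)) (y : ι' → A) (w : κ → A) :
    φ ∘ β.adjFst y w = β.adjFst (φ ∘ y) (φ ∘ w) := by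
  funext i
  simp only [Function.comp_apply, BiOp.adjFst, Finsupp.sum, map_sum,
    show ∀ (s : Idx m Γ) a, φ (DopAdj s a) = DopAdj s (φ a) from hφ.map_DopAdj, map_smul, map_mul,
    show ∀ (s : Idx m Γ) a, φ (Dop s a) = Dop s (φ a) from hφ.map_Dop]

theorem BiOp.map_adjSnd [Fintype ι] [Fintype κ]
    (β : BiOp m Γ ι ι' κ R) {φ : A →ₐ[R] B}
    (hφ : IsDDMap m Γ (φ : A →+ B)) (x : ι → A) (w : κ → A) :
    φ ∘ β.adjSnd x w = β.adjSnd (φ ∘ x) (φ ∘ w) := by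
  funext i
  simp only [Function.comp_apply, BiOp.adjSnd, Finsupp.sum, map_sum,
    show ∀ (s : Idx m Γ) a, φ (DopAdj s a) = DopAdj s (φ a) from hφ.map_DopAdj, map_smul, map_mul,
    show ∀ (s : Idx m Γ) a, φ (Dop s a) = Dop s (φ a) from hφ.map_Dop]

theorem LinOp.app_add [Fintype ι]
    (T : LinOp m Γ ι κ R) (x y : ι → A) :
    T.app (x + y) = T.app x + T.app y := by
  funext k
  simp only [LinOp.app, Finsupp.sum, Pi.add_apply, map_add, smul_add, Finset.sum_add_distrib]

theorem LinOp.app_neg [Fintype ι]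
    (T : LinOp m Γ ι κ R) (x : ι → A) : T.app (-x) = -T.app x := by
  funext k
  simp only [LinOp.app, Finsupp.sum, Pi.neg_apply, map_neg, smul_neg, Finset.sum_neg_distrib]

theorem BiOp.app_add_left [Fintype ι] [Fintype ι']
    (β : BiOp m Γ ι ι' κ R) (x x' : ι → A) (y : ι' → A) :
    β.app (x + x') y = β.app x y + β.app x' y := by
  funext k
  simp only [BiOp.app, Finsupp.sum, Pi.add_apply, map_add, add_mul, smul_add,
    Finset.sum_add_distrib]

theorem BiOp.app_neg_left [Fintype ι] [Fintype ι']
    (β : BiOp m Γ ι ι' κ R) (x : ι → A) (y : ι' → A) : β.app (-x) y = -β.app x y := by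
  funext k
  simp only [BiOp.app, Finsupp.sum, Pi.neg_apply, map_neg, neg_mul, smul_neg,
    Finset.sum_neg_distrib]

theorem BiOp.adjSnd_neg_left [Fintype ι] [Fintype κ]
    (β : BiOp m Γ ι ι' κ R) (x : ι → A) (w : κ → A) : β.adjSnd (-x) w = -β.adjSnd x w := by
  funext i
  simp only [BiOp.adjSnd, Finsupp.sum, Pi.neg_apply, map_neg, neg_mul, smul_neg,
    Finset.sum_neg_distrib]

theorem BiOp.adjFst_neg_right [Fintype ι'] [Fintype κ]
    (β : BiOp m Γ ι ι' κ R) (y : ι' → A) (w : κ → A) :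
    β.adjFst y (-w) = -β.adjFst y w := by
  funext i
  simp only [BiOp.adjFst, Finsupp.sum, Pi.neg_apply, map_neg, mul_neg, smul_neg,
    Finset.sum_neg_distrib]

theorem BiOp.adjSnd_add_left [Fintype ι] [Fintype κ]
    (β : BiOp m Γ ι ι' κ R) (x x' : ι → A) (w : κ → A) :
    β.adjSnd (x + x') w = β.adjSnd x w + β.adjSnd x' w := by
  funext i
  simp only [BiOp.adjSnd, Finsupp.sum, Pi.add_apply, map_add, add_mul, smul_add,
    Finset.sum_add_distrib]

/-- The adjoint is bilinear in `(y, w)` and its coefficients lie in `R`, over which `D` is linear,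
so only the two arguments get differentiated. For ∇ this is the product rule for x∇p. -/
theorem BiOp.derivation_adjFst [Fintype ι'] [Fintype κ]
    (β : BiOp m Γ ι ι' κ R) {φ : A →ₐ[R] B} {D : A →ₗ[R] B}
    (h : IsDDDerivation m Γ φ D) (y : ι' → A) (w : κ → A) :
    D ∘ β.adjFst y w = β.adjFst (D ∘ y) (φ ∘ w) + β.adjFst (φ ∘ y) (D ∘ w) := by
  funext i
  simp only [Function.comp_apply, BiOp.adjFst, Finsupp.sum, map_sum, Pi.add_apply,
    show ∀ (s : Idx m Γ) a, D (DopAdj s a) = DopAdj s (D a) from h.der.map_DopAdj, map_smul,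
    h.leibniz, show ∀ (s : Idx m Γ) a, φ (Dop s a) = Dop s (φ a) from h.hom.map_Dop,
    show ∀ (s : Idx m Γ) a, D (Dop s a) = Dop s (D a) from h.der.map_Dop,
    ← Finset.sum_add_distrib, ← map_add, ← smul_add]
  simp only [add_comm]

end Ops

end Commuting

/-! ## Evolution derivations along homomorphisms -/

section Evolution

/-- One finite set serves all `i`, so the sums defining the variational derivatives can share an
index set. -/
theorem exists_pderiv_eq_zero {κ τ R : Type*} [CommRing R] (p : MvPolynomial (κ × τ) R) :
    ∃ S : Finset τ, ∀ i, ∀ s ∉ S, pderiv (i, s) p = 0 := by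
  classical
  refine ⟨p.vars.image Prod.snd, fun i s hs => pderiv_eq_zero_of_notMem_vars fun h => hs ?_⟩
  exact Finset.mem_image_of_mem _ h

variable {m : ℕ} {Γ : Type*} [Group Γ] {κ : Type*} {R : Type*} [CommRing R]
  {K : Type*} [CommRing K] [DDRing m Γ K] [Algebra R K]

/-- `D` is the evolution derivation `R[q_i^{(s)}] → K` along `φ` with `D(q_i^{(s)}) = D^s(ξ_i)`. -/
structure IsEvolution (φ : Jet m Γ κ R →ₐ[R] K) (D : Jet m Γ κ R →ₗ[R] K) (ξ : κ → K) : Prop where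
  leibniz : ∀ a b, D (a * b) = φ a * D b + D a * φ b
  map_X : ∀ v, D (X v) = Dop v.2 (ξ v.1)

variable {φ : Jet m Γ κ R →ₐ[R] K} {D D' : Jet m Γ κ R →ₗ[R] K} {ξ : κ → K}

theorem IsEvolution.map_C (h : IsEvolution φ D ξ) (r : R) : D (C r) = 0 := by
  have h1 : D 1 = 0 := by simpa using h.leibniz 1 1
  rw [← mul_one (C r), ← smul_eq_C_mul, map_smul, h1, smul_zero]

theorem IsEvolution.map_gen (h : IsEvolution φ D ξ) (i : κ) : D (gen i) = ξ i := by
  rw [gen, h.map_X]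
  simp only [Dop, derPow_zero, mul_one, actEnd_apply, map_one]
  rfl

theorem IsEvolution.unique (h : IsEvolution φ D ξ) (h' : IsEvolution φ D' ξ) : D = D' := by
  refine LinearMap.ext fun p => ?_
  induction p using MvPolynomial.induction_on with
  | C r => rw [h.map_C, h'.map_C]
  | add p q hp hq => rw [map_add, map_add, hp, hq]
  | mul_X p v hp => rw [h.leibniz, h'.leibniz, hp, h.map_X, h'.map_X]

/-- Allowing every `T` containing `S` lets index sets be enlarged freely, both in the induction and
when matching the sum with the one in `varDer`. -/
theorem IsEvolution.exists_eq_sum (h : IsEvolution φ D ξ) (p : Jet m Γ κ R) :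
    ∃ S : Finset (κ × Idx m Γ), ∀ T, S ⊆ T →
      D p = ∑ v ∈ T, φ (pderiv v p) * Dop v.2 (ξ v.1) := by
  classical
  induction p using MvPolynomial.induction_on with
  | C r => exact ⟨∅, fun T _ => by simp [h.map_C]⟩
  | add p q hp hq =>
    obtain ⟨S, hS⟩ := hp
    obtain ⟨S', hS'⟩ := hq
    refine ⟨S ∪ S', fun T hT => ?_⟩
    rw [map_add, hS T (Finset.union_subset_left hT), hS' T (Finset.union_subset_right hT)]
    simp only [map_add, add_mul, Finset.sum_add_distrib]
  | mul_X p v hp =>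
    obtain ⟨S, hS⟩ := hp
    refine ⟨insert v S, fun T hT => ?_⟩
    have hv : v ∈ T := hT (Finset.mem_insert_self _ _)
    rw [h.leibniz, hS T ((Finset.subset_insert _ _).trans hT), h.map_X]
    simp only [Derivation.leibniz, smul_eq_mul, pderiv_X, map_add, map_mul, add_mul,
      Finset.sum_add_distrib, Finset.sum_mul]
    congr 1
    · rw [Finset.sum_eq_single_of_mem v hv]
      · simp
      · intro b _ hb
        simp [Pi.single_eq_of_ne hb.symm]
    · exact Finset.sum_congr rfl fun _ _ => by ring

variable [DDRing m Γ R]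

/-- On generators, D(q^{(s)}) = D^s(ξ) is already compatible with ∂_l and ĝ; the Leibniz rule
propagates this to products. -/
theorem IsEvolution.isDDDerivation (h : IsEvolution φ D ξ) (hφ : IsDDMap m Γ (φ : Jet m Γ κ R →+ K)) :
    IsDDDerivation m Γ φ D where
  hom := hφ
  leibniz := h.leibniz
  der :=
    { map_der := fun l p => by
        change D (jetDer l p) = DDRing.der Γ l (D p)
        have hφl : ∀ a, φ (jetDer l a) = DDRing.der Γ l (φ a) := hφ.map_der l
        induction p using MvPolynomial.induction_on with
        | C r => rw [jetDer_C, h.map_C, h.map_C, map_zero]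
        | add p q hp hq => simp only [map_add, hp, hq]
        | mul_X p v hp =>
          simp only [Derivation.leibniz, map_add, h.leibniz, hp, jetDer_X, smul_eq_mul, h.map_X,
            ← hφl, Dop_add_single]
          ring
      map_act := fun g p => by
        change D (jetAct g p) = DDRing.act m g (D p)
        have hφg : ∀ a, φ (jetAct g a) = DDRing.act m g (φ a) := hφ.map_act g
        induction p using MvPolynomial.induction_on with
        | C r => rw [jetAct_C, h.map_C, h.map_C, map_zero]
        | add p q hp hq => simp only [map_add, hp, hq]
        | mul_X p v hp =>
          rw [map_mul, h.leibniz, h.leibniz, hp, hφg, hφg, jetAct_X, h.map_X, h.map_X,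
            Dop_mul_left, map_add (DDRing.act m g : K →+* K), map_mul, map_mul] }

theorem varDer_eq_sum {p : Jet m Γ κ R} {i : κ} {S : Finset (Idx m Γ)}
    (hS : ∀ s ∉ S, pderiv (i, s) p = 0) :
    varDer p i = ∑ s ∈ S, DopAdj s (pderiv (i, s) p) :=
  finsum_eq_sum_of_support_subset _ fun s hs => by
    by_contra hn
    exact hs (by simp only; rw [hS s hn, map_zero])

/-- The first variation formula. -/
theorem IsEvolution.sim_pairing_varDer [Fintype κ] (h : IsEvolution φ D ξ)
    (hφ : IsDDMap m Γ (φ : Jet m Γ κ R →+ K)) (p : Jet m Γ κ R) :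
    Sim m Γ (D p) (pairing (φ ∘ varDer p) ξ) := by
  classical
  obtain ⟨S, hS⟩ := h.exists_eq_sum p
  obtain ⟨T, hT⟩ := exists_pderiv_eq_zero p
  -- The index set has to be a product, to be split by `i`; its second factor must carry both the
  -- support of `D p` and that of every `varDer p i`.
  rw [hS (Finset.univ ×ˢ (T ∪ S.image Prod.snd)) fun v hv => by
    simp only [Finset.mem_product, Finset.mem_univ, true_and]
    exact Finset.mem_union_right _ (Finset.mem_image_of_mem _ hv)]
  rw [Finset.sum_product, pairing]
  refine Sim.sum fun i _ => ?_
  rw [Function.comp_apply, varDer_eq_sum (S := T ∪ S.image Prod.snd) fun s hs =>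
    hT i s fun hs' => hs (Finset.mem_union_left _ hs'), map_sum, Finset.sum_mul]
  refine Sim.sum fun s _ => ?_
  rw [show φ (DopAdj s _) = DopAdj s (φ _) from hφ.map_DopAdj s _]
  exact sim_Dop s _ _

end Evolution

/-! ## The variational derivative annihilates trivial elements -/

section VarDer

variable {m : ℕ} {Γ : Type*} [Group Γ]

section DopAdj

variable {A : Type*} [CommRing A] [DDRing m Γ A]

theorem DopAdj_add_single (g : Γ) (σ : Fin m → ℕ) (l : Fin m) (a : A) :
    DopAdj (g, σ + Pi.single l 1) a = -DopAdj (g, σ) ((DDRing.der Γ l : Derivation ℤ A A) a) := by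
  have e : ∑ k, (σ + Pi.single l 1 : Fin m → ℕ) k = (∑ k, σ k) + 1 := by
    simp [Finset.sum_add_distrib]
  have hc : derEnd Γ A l * derPow Γ A σ = derPow Γ A σ * derEnd Γ A l :=
    Finset.noncommProd_commute _ _ _ _ fun j _ => (derEnd_commute l j).pow_right _
  simp only [DopAdj, e, derPow_add_single, hc, LinearMap.smul_apply, Module.End.mul_apply,
    derEnd_apply, actEnd_apply, DDRing.act_der, pow_succ, mul_smul, neg_smul, one_smul, smul_neg,
    LinearMap.neg_apply]

theorem DopAdj_act (g h : Γ) (σ : Fin m → ℕ) (a : A) :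
    DopAdj (h, σ) ((DDRing.act m g : A →+* A) a) = DopAdj (g⁻¹ * h, σ) a := by
  simp only [DopAdj, LinearMap.smul_apply, Module.End.mul_apply, actEnd_apply, mul_inv_rev,
    inv_inv, map_mul]
  rfl

theorem DopAdj_one (a : A) : DopAdj ((1 : Γ), (0 : Fin m → ℕ)) a = a := by
  simp only [DopAdj, LinearMap.smul_apply, Module.End.mul_apply, actEnd_apply, inv_one, map_one,
    derPow_zero]
  simp

end DopAdj

variable {κ : Type*} {R : Type*} [CommRing R] [DDRing m Γ R]

/-- Since ∂_l q^{(g|σ)} = q^{(g|σ+e_l)}, the commutator of ∂/∂q^{(g|σ+e_l)} with ∂_l is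
∂/∂q^{(g|σ)}. -/
theorem pderiv_jetDer_add_single (l : Fin m) (i : κ) (s : Idx m Γ) (p : Jet m Γ κ R) :
    pderiv (i, (s.1, s.2 + Pi.single l 1)) (jetDer l p)
      = jetDer l (pderiv (i, (s.1, s.2 + Pi.single l 1)) p) + pderiv (i, s) p := by
  classical
  induction p using MvPolynomial.induction_on with
  | C r => simp [jetDer_C]
  | add p q hp hq => simp only [map_add, hp, hq]; ring
  | mul_X p v hp =>
    have h1 : (Pi.single (i, (s.1, s.2 + Pi.single l 1)) 1 : κ × Idx m Γ → Jet m Γ κ R)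
        (v.1, (v.2.1, v.2.2 + Pi.single l 1))
          = (Pi.single (i, s) 1 : κ × Idx m Γ → Jet m Γ κ R) v := by
      simp only [Pi.single_apply, Prod.ext_iff, add_left_inj]
    have h2 : jetDer l ((Pi.single (i, (s.1, s.2 + Pi.single l 1)) 1 :
        κ × Idx m Γ → Jet m Γ κ R) v) = 0 := by
      rw [Pi.single_apply]; split_ifs <;> simp
    simp only [Derivation.leibniz, map_add, hp, jetDer_X, smul_eq_mul, pderiv_X, h1, h2]
    ring

/-- With s_l = 0, no generator is sent by ∂_l to q^{(s)}, so the commutator vanishes. -/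
theorem pderiv_jetDer_of_eq_zero (l : Fin m) (i : κ) {s : Idx m Γ} (hs : s.2 l = 0)
    (p : Jet m Γ κ R) : pderiv (i, s) (jetDer l p) = jetDer l (pderiv (i, s) p) := by
  classical
  induction p using MvPolynomial.induction_on with
  | C r => simp [jetDer_C]
  | add p q hp hq => simp only [map_add, hp, hq]
  | mul_X p v hp =>
    have h1 : (Pi.single (i, s) 1 : κ × Idx m Γ → Jet m Γ κ R)
        (v.1, (v.2.1, v.2.2 + Pi.single l 1)) = 0 := by
      refine Pi.single_eq_of_ne (fun h => ?_) _
      have := congrArg (fun w : κ × Idx m Γ => w.2.2 l) h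
      simp [hs] at this
    have h2 : jetDer l ((Pi.single (i, s) 1 : κ × Idx m Γ → Jet m Γ κ R) v) = 0 := by
      rw [Pi.single_apply]; split_ifs <;> simp
    simp only [Derivation.leibniz, map_add, hp, jetDer_X, smul_eq_mul, pderiv_X, h1, h2]
    ring

theorem pderiv_jetAct (g h : Γ) (σ : Fin m → ℕ) (i : κ) (p : Jet m Γ κ R) :
    pderiv (i, (h, σ)) (jetAct g p) = jetAct g (pderiv (i, (g⁻¹ * h, σ)) p) := by
  classical
  induction p using MvPolynomial.induction_on with
  | C r => simp [jetAct_C]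
  | add p q hp hq => simp only [map_add, hp, hq]
  | mul_X p v hp =>
    have h1 : (Pi.single (i, (h, σ)) 1 : κ × Idx m Γ → Jet m Γ κ R)
        (v.1, (g * v.2.1, v.2.2))
          = jetAct g ((Pi.single (i, (g⁻¹ * h, σ)) 1 : κ × Idx m Γ → Jet m Γ κ R) v) := by
      simp only [Pi.single_apply, Prod.ext_iff, eq_inv_mul_iff_mul_eq]
      split_ifs <;> simp
    simp only [Derivation.leibniz, map_add, map_mul, hp, jetAct_X, smul_eq_mul, pderiv_X, h1]

theorem finite_support_DopAdj_pderiv (i : κ) (p : Jet m Γ κ R) :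
    (Function.support fun s : Idx m Γ => DopAdj s (pderiv (i, s) p)).Finite := by
  obtain ⟨S, hS⟩ := exists_pderiv_eq_zero p
  refine S.finite_toSet.subset fun s hs => ?_
  by_contra hn
  exact hs (by simp only; rw [hS i s hn, map_zero])

/-- The variational derivative as an additive map. -/
def varDerHom (i : κ) : Jet m Γ κ R →+ Jet m Γ κ R :=
  AddMonoidHom.mk' (fun p => varDer p i) fun p q => by
    simp only [varDer, map_add]
    exact finsum_add_distrib (finite_support_DopAdj_pderiv i p) (finite_support_DopAdj_pderiv i q)

/-- Commuting ∂/∂q^{(s)} past ∂_l leaves ∑ (D^s)^†∂_l(∂p/∂q^{(s)}) plus the commutator terms.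
Reindexed by s ↦ s + e_l, the latter carry (D^{s+e_l})^† = −(D^s)^†∂_l and cancel the former. -/
theorem varDer_jetDer (l : Fin m) (p : Jet m Γ κ R) (i : κ) : varDer (jetDer l p) i = 0 := by
  classical
  let e : Idx m Γ → Idx m Γ := fun s => (s.1, s.2 + Pi.single l 1)
  have he : Function.Injective e := fun s t h => by
    simpa [e, Prod.ext_iff] using h
  -- The commutator terms, supported on the image of the shift `e`.
  let G : Idx m Γ → Jet m Γ κ R := fun s =>
    DopAdj s (pderiv (i, s) (jetDer l p)) - DopAdj s (jetDer l (pderiv (i, s) p))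
  have hG : Function.support G ⊆ Set.range e := fun s hs => by
    by_contra hn
    refine hs ?_
    have h0 : s.2 l = 0 := by
      by_contra h0
      -- The subtraction of natural numbers is truncated, but s_l ≠ 0 makes it a true preimage under
      -- the shift.
      refine hn ⟨(s.1, s.2 - Pi.single l 1), Prod.ext rfl (funext fun j => ?_)⟩
      by_cases hj : j = l
      · subst hj; simp [e]; omega
      · simp [e, hj]
    simp only [G, pderiv_jetDer_of_eq_zero l i h0, sub_self]
  have hF : (Function.support fun s : Idx m Γ =>
      DopAdj s (jetDer l (pderiv (i, s) p))).Finite := by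
    obtain ⟨S, hS⟩ := exists_pderiv_eq_zero p
    refine S.finite_toSet.subset fun s hs => ?_
    by_contra hn
    exact hs (by simp only; rw [hS i s hn, map_zero, map_zero])
  have h2 : ∑ᶠ s, G s = -∑ᶠ s : Idx m Γ, DopAdj s (jetDer l (pderiv (i, s) p)) := by
    rw [← Set.indicator_eq_self.2 hG, ← finsum_mem_def, finsum_mem_range he,
      ← finsum_neg_distrib]
    refine finsum_congr fun s => ?_
    simp only [G, e, pderiv_jetDer_add_single, map_add, add_sub_cancel_left]
    exact DopAdj_add_single _ _ _ _
  have h3 := finsum_sub_distrib (finite_support_DopAdj_pderiv i (jetDer l p)) hF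
  rw [show varDer (jetDer l p) i = ∑ᶠ s : Idx m Γ, DopAdj s (pderiv (i, s) (jetDer l p)) from rfl,
    ← add_left_inj (-∑ᶠ s : Idx m Γ, DopAdj s (jetDer l (pderiv (i, s) p))), ← sub_eq_add_neg,
    ← h3, zero_add]
  exact h2

/-- The action of ĝ permutes the generators, and (D^{(h,σ)})^†ĝ = (D^{(g⁻¹h,σ)})^†, so the sum is
merely reindexed by left translation. -/
theorem varDer_jetAct (g : Γ) (p : Jet m Γ κ R) (i : κ) :
    varDer (jetAct g p) i = varDer p i := by
  let e : Idx m Γ ≃ Idx m Γ := (Equiv.mulLeft g⁻¹).prodCongr (Equiv.refl _)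
  unfold varDer
  rw [← finsum_comp_equiv e (f := fun s : Idx m Γ => DopAdj s (pderiv (i, s) p))]
  refine finsum_congr fun s => ?_
  rw [show s = (s.1, s.2) from rfl, pderiv_jetAct]
  exact DopAdj_act _ _ _ _

theorem Sim.varDer_eq {p q : Jet m Γ κ R} (h : Sim m Γ p q) : varDer p = varDer q := by
  funext i
  have hle : trivialElts m Γ (Jet m Γ κ R) ≤ (varDerHom i).ker := by
    refine sup_le (iSup_le fun l => ?_) (iSup_le fun g => ?_)
    · rintro _ ⟨p, rfl⟩
      exact varDer_jetDer l p i
    · rintro _ ⟨p, rfl⟩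
      change varDerHom i (jetAct g p - p) = 0
      rw [map_sub, sub_eq_zero]
      exact varDer_jetAct g p i
  have := hle h
  rw [AddMonoidHom.mem_ker, map_sub, sub_eq_zero] at this
  exact this

/-- The functional is linear in the undifferentiated generators, so only the index (e, 0)
contributes. -/
theorem varDer_pairing_C_gen [Fintype κ] (a : κ → R) :
    varDer (pairing (C ∘ a) gen : Jet m Γ κ R) = C ∘ a := by
  classical
  have h : ∀ i (s : Idx m Γ), pderiv (i, s) (pairing (C ∘ a) gen : Jet m Γ κ R)
      = if s = (1, 0) then C (a i) else 0 := fun i s => by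
    simp only [pairing, gen, Function.comp_apply, map_sum, Derivation.leibniz, pderiv_C,
      add_zero, pderiv_X, Pi.single_apply, Prod.mk.injEq, smul_eq_mul, mul_ite, mul_one, mul_zero]
    split_ifs with hs
    · simp [← hs]
    · refine Finset.sum_eq_zero fun j _ => if_neg fun hj => hs hj.2.symm
  funext i
  rw [varDer_eq_sum (S := {(1, 0)}) fun s hs => by
    rw [h, if_neg (by simpa using hs)], Finset.sum_singleton, h, if_pos rfl, DopAdj_one]
  rfl

/-- The fundamental lemma of the calculus of variations. -/
theorem eq_of_sim_pairing_gen [Fintype κ] {a b : κ → R}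
    (h : Sim m Γ (pairing (C ∘ a) gen : Jet m Γ κ R) (pairing (C ∘ b) gen)) : a = b := by
  have := h.varDer_eq
  rw [varDer_pairing_C_gen, varDer_pairing_C_gen] at this
  exact funext fun i => C_injective _ _ (congrFun this i)

end VarDer

/-! ### Adjoining independent variables; composing evolution derivations with homomorphisms. -/

section Constants

variable {m : ℕ} {Γ : Type*} [Group Γ] {R K : Type*} [CommRing R]
  [CommRing K] [DDRing m Γ K] [Algebra R K] {κ : Type*}

variable (m Γ R K κ) in
/-- The embedding of an extension `K` of `R` into `K[q_i^{(s)}]`. -/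
def constHom : K →ₐ[R] Jet m Γ κ K := IsScalarTower.toAlgHom R K (Jet m Γ κ K)

theorem isDDMap_constHom : IsDDMap m Γ (constHom m Γ R K κ : K →+ Jet m Γ κ K) where
  map_der l a := (jetDer_C l a).symm
  map_act g a := (jetAct_C g a).symm

theorem isDDMap_id : IsDDMap m Γ (AlgHom.id R K : K →+ K) where
  map_der _ _ := rfl
  map_act _ _ := rfl

variable [DDRing m Γ R]

/-- The Lie algebra and representation axioms are available over extensions of `R`; this makes them
available after new variables are adjoined to `K`. -/
instance jetDDExt_of_ext [DDExt m Γ R K] : DDExt m Γ R (Jet m Γ κ K) where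
  injective := (constHom m Γ R K κ).comp_algebraMap ▸
    (C_injective (κ × Idx m Γ) K).comp (DDExt.injective m Γ)
  der_algebraMap l r := by
    rw [← (constHom m Γ R K κ).commutes, ← (constHom m Γ R K κ).commutes,
      ← DDExt.der_algebraMap (K := K)]
    exact ((isDDMap_constHom (R := R)).map_der l _).symm
  act_algebraMap g r := by
    rw [← (constHom m Γ R K κ).commutes, ← (constHom m Γ R K κ).commutes,
      ← DDExt.act_algebraMap (K := K)]
    exact ((isDDMap_constHom (R := R)).map_act g _).symm

theorem isDDMap_jetHom {κ' : Type*} (w : κ → Jet m Γ κ' R) :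
    IsDDMap m Γ (jetHom w : Jet m Γ κ R →+ Jet m Γ κ' R) where
  map_der := jetHom_der w
  map_act := jetHom_act w

theorem isEvolution_evol (ξ : κ → Jet m Γ κ R) :
    IsEvolution (AlgHom.id R (Jet m Γ κ R)) (evol ξ).toLinearMap ξ where
  leibniz a b := by
    change evol ξ (a * b) = a * evol ξ b + evol ξ a * b
    rw [Derivation.leibniz, smul_eq_mul, smul_eq_mul, mul_comm b]
  map_X v := mkDerivation_X _ _ _

/-- The variation of differential functions in the direction of independent variables. -/
theorem isEvolution_gen : IsEvolution (constHom m Γ R (Jet m Γ κ R) κ)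
    (mkDerivation R fun v : κ × Idx m Γ =>
      (Dop v.2 (gen v.1) : Jet m Γ κ (Jet m Γ κ R))).toLinearMap gen where
  leibniz a b := by
    refine (Derivation.leibniz _ a b).trans ?_
    rw [Algebra.smul_def, Algebra.smul_def, mul_comm (algebraMap _ _ b)]
    rfl
  map_X v := mkDerivation_X _ _ _

/-- Chain rule: an evolution derivation composed with `Φ` is an evolution derivation along `Φ`. -/
theorem IsEvolution.comp_jetHom {κ' : Type*} {φ : Jet m Γ κ' R →ₐ[R] K} {D : Jet m Γ κ' R →ₗ[R] K}
    {ξ : κ' → K} (h : IsEvolution φ D ξ) (hφ : IsDDMap m Γ (φ : Jet m Γ κ' R →+ K))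
    (w : κ → Jet m Γ κ' R) :
    IsEvolution (φ.comp (jetHom w)) (D ∘ₗ (jetHom w).toLinearMap) (D ∘ w) where
  leibniz a b := by simp [h.leibniz]
  map_X v := by
    simp only [LinearMap.comp_apply, AlgHom.toLinearMap_apply, jetHom, aeval_X]
    exact (h.isDDDerivation hφ).der.map_Dop _ _

/-- Counterpart of `IsEvolution.comp_jetHom`: there the homomorphism precedes the evolution, here it
follows it. Both composites are evolutions along a homomorphism, hence comparable by
`IsEvolution.unique`. -/
theorem IsDDMap.comp_evol {Φ : Jet m Γ κ R →ₐ[R] K}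
    (hΦ : IsDDMap m Γ (Φ : Jet m Γ κ R →+ K)) (ξ : κ → Jet m Γ κ R) :
    IsEvolution Φ (Φ.toLinearMap ∘ₗ (evol ξ).toLinearMap) (Φ ∘ ξ) where
  leibniz a b := by
    change Φ (evol ξ (a * b)) = Φ a * Φ (evol ξ b) + Φ (evol ξ a) * Φ b
    rw [Derivation.leibniz, smul_eq_mul, smul_eq_mul, map_add, map_mul, map_mul, mul_comm (Φ b)]
  map_X v := by
    change Φ (evol ξ (X v)) = _
    rw [evol, mkDerivation_X]
    exact hΦ.map_Dop _ _

theorem sim_poisson [Fintype κ] (B : (κ → Jet m Γ κ R) → (κ → Jet m Γ κ R))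
    (H F : Jet m Γ κ R) :
    Sim m Γ (poisson B H F) (pairing (varDer F) (B (varDer H))) :=
  (isEvolution_evol (B (varDer H))).sim_pairing_varDer isDDMap_id F

end Constants

/-! ### Adjoint identities and equivariance of ∇. -/

section Duality

theorem DDLieAlgebra.map_coad {m : ℕ} {Γ : Type u} [Group Γ] {R : Type u} [CommRing R]
    [DDRing m Γ R] {N : ℕ} {L : DDLieAlgebra m Γ R N} {A B : Type u} [CommRing A] [DDRing m Γ A]
    [Algebra R A] [CommRing B] [DDRing m Γ B] [Algebra R B] {φ : A →ₐ[R] B}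
    (hφ : IsDDMap m Γ (φ : A →+ B)) (X u : Fin N → A) :
    φ ∘ L.coad X u = L.coad (φ ∘ X) (φ ∘ u) := by
  rw [DDLieAlgebra.coad, DDLieAlgebra.coad, ← BiOp.map_adjSnd _ hφ]
  exact funext fun i => map_neg φ _

variable {m : ℕ} {Γ : Type u} [Group Γ] {R : Type u} [CommRing R] [DDRing m Γ R]
  {N n : ℕ} {L : DDLieAlgebra m Γ R N} (χ : L.Rep n) (O : L.OOperator)
  {K : Type u} [CommRing K] [DDRing m Γ K] [Algebra R K]

theorem sim_pairing_smul (X : Fin N → K) (v v' : Fin n → K) :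
    Sim m Γ (pairing v' (χ.smul X v)) (pairing (χ.nabla v v') X) :=
  (χ.sim_nabla v v' X).symm

theorem sim_pairing_dual (X : Fin N → K) (v v' : Fin n → K) :
    Sim m Γ (pairing v (χ.dual X v')) (-pairing (χ.nabla v v') X) := by
  rw [pairing_comm]
  exact (χ.sim_dual X v v').trans (sim_pairing_smul χ X v v').neg

variable [DDExt m Γ R K]

/-- For fixed `u` the operator X ↦ X˙u is skewsymmetric because the bracket is. -/
theorem sim_pairing_coad (X u Y : Fin N → K) :
    Sim m Γ (pairing Y (L.coad X u)) (-pairing (L.coad Y u) X) := by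
  rw [pairing_comm]
  refine (DDLieAlgebra.sim_coad X u Y).trans ?_
  rw [L.skew K X Y, pairing_neg_right]
  exact (DDLieAlgebra.sim_coad Y u X).symm.neg

/-- Tested against `T`, the left side becomes −⟨v', [Z,T].v⟩; expanding χ([Z,T]) as a commutator and
moving Z onto `v'` in one of the two terms gives the right side. -/
theorem sim_pairing_coad_nabla (Z T : Fin N → K) (v v' : Fin n → K) :
    Sim m Γ (pairing (L.coad Z (χ.nabla v v')) T)
      (pairing (χ.nabla (χ.smul Z v) v' + χ.nabla v (χ.dual Z v')) T) := by
  refine (DDLieAlgebra.sim_coad Z _ T).trans ((χ.sim_nabla v v' _).neg.trans ?_)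
  have h : χ.smul (L.bracket.app Z T) v = χ.smul Z (χ.smul T v) - χ.smul T (χ.smul Z v) :=
    χ.map_lie K Z T v
  rw [h, pairing_sub_right, neg_sub, sub_eq_add_neg, pairing_add_left]
  refine (χ.sim_nabla (χ.smul Z v) v' T).symm.add ?_
  exact (χ.sim_dual Z (χ.smul T v) v').symm.trans (χ.sim_nabla v (χ.dual Z v') T).symm

/-- The map `∇` is equivariant. -/
theorem coad_nabla (Z : Fin N → K) (v v' : Fin n → K) :
    L.coad Z (χ.nabla v v') = χ.nabla (χ.smul Z v) v' + χ.nabla v (χ.dual Z v') := by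
  have hc : IsDDMap m Γ (constHom m Γ R K (Fin N) : K →+ Jet m Γ (Fin N) K) := isDDMap_constHom
  have hneg : ∀ {l : ℕ} (a : Fin l → K), constHom m Γ R K (Fin N) ∘ (-a)
      = -(constHom m Γ R K (Fin N) ∘ a) := fun a => funext fun i => map_neg _ _
  have hadd : ∀ {l : ℕ} (a b : Fin l → K), constHom m Γ R K (Fin N) ∘ (a + b)
      = constHom m Γ R K (Fin N) ∘ a + constHom m Γ R K (Fin N) ∘ b :=
    fun a b => funext fun i => map_add _ _ _
  -- The test vector consists of new variables over `K`, while the other arguments are constants.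
  -- After `constHom` is pulled out of all operators, the fundamental lemma applies.
  have h := sim_pairing_coad_nabla χ (constHom m Γ R K (Fin N) ∘ Z) gen
    (constHom m Γ R K (Fin N) ∘ v) (constHom m Γ R K (Fin N) ∘ v')
  simp only [DDLieAlgebra.coad, DDLieAlgebra.Rep.nabla, DDLieAlgebra.Rep.smul,
    DDLieAlgebra.Rep.dual, ← BiOp.map_adjFst _ hc, ← BiOp.map_adjSnd _ hc, ← BiOp.map_app _ hc,
    ← hneg, ← hadd] at h
  exact eq_of_sim_pairing_gen h

end Duality

/-! ### The quadratic brackets and the Clebsch map. -/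

section Main

variable {m : ℕ} {Γ : Type u} [Group Γ] {R : Type u} [CommRing R] [DDRing m Γ R]
  {N n : ℕ} {L : DDLieAlgebra m Γ R N} (χ : L.Rep n) (O : L.OOperator)

/-- Each block formula is one passage to the adjoint, through ∇ or the dual action, followed by one
use of the skewsymmetry of 𝒪. -/
theorem sim_pairing_Bxx (M M' : Fin n → FunVV m Γ R n) :
    Sim m Γ (pairing M' (Bxx χ O M))
      (pairing (χ.nabla (xVec m Γ R n) M) (O.op.app (χ.nabla (xVec m Γ R n) M'))) := by
  rw [Bxx, pairing_neg_right]
  simpa using ((sim_pairing_smul χ _ _ M').trans (O.skew _ _ _)).neg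

theorem sim_pairing_Bxp (M M' : Fin n → FunVV m Γ R n) :
    Sim m Γ (pairing M' (Bxp χ O M))
      (-pairing (χ.nabla M (pVec m Γ R n)) (O.op.app (χ.nabla (xVec m Γ R n) M'))) :=
  (sim_pairing_smul χ _ _ M').trans (O.skew _ _ _)

theorem sim_pairing_Bpx (M M' : Fin n → FunVV m Γ R n) :
    Sim m Γ (pairing M' (Bpx χ O M))
      (-pairing (χ.nabla (xVec m Γ R n) M) (O.op.app (χ.nabla M' (pVec m Γ R n)))) := by
  rw [Bpx, pairing_neg_right]
  have h := (sim_pairing_dual χ (O.op.app (χ.nabla (xVec m Γ R n) M)) M' (pVec m Γ R n)).neg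
  rw [neg_neg] at h
  exact h.trans (O.skew _ _ _)

theorem sim_pairing_Bpp (M M' : Fin n → FunVV m Γ R n) :
    Sim m Γ (pairing M' (Bpp χ O M))
      (pairing (χ.nabla M (pVec m Γ R n)) (O.op.app (χ.nabla M' (pVec m Γ R n)))) := by
  refine (sim_pairing_dual χ _ M' _).trans ?_
  simpa using (O.skew _ (χ.nabla M' (pVec m Γ R n)) (χ.nabla M (pVec m Γ R n))).neg

/-- The covector `x ∇ M_x - M_p ∇ p`. -/
def clebschMoment (M : Fin n ⊕ Fin n → FunVV m Γ R n) : Fin N → FunVV m Γ R n :=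
  χ.nabla (xVec m Γ R n) (M ∘ Sum.inl) - χ.nabla (M ∘ Sum.inr) (pVec m Γ R n)

/-- The four block formulae are exactly the expansion of a single form in the moments, visibly skew
modulo trivial elements. -/
theorem sim_pairing_clebschB (M M' : Fin n ⊕ Fin n → FunVV m Γ R n) :
    Sim m Γ (pairing M' (clebschB χ O M))
      (pairing (clebschMoment χ M) (O.op.app (clebschMoment χ M'))) := by
  rw [pairing_sumElim]
  simp only [clebschB, Sum.elim_comp_inl, Sum.elim_comp_inr, pairing_add_right]
  have h := ((sim_pairing_Bxx χ O (M ∘ Sum.inl) (M' ∘ Sum.inl)).add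
    (sim_pairing_Bxp χ O (M ∘ Sum.inr) (M' ∘ Sum.inl))).add
    ((sim_pairing_Bpx χ O (M ∘ Sum.inl) (M' ∘ Sum.inr)).add
    (sim_pairing_Bpp χ O (M ∘ Sum.inr) (M' ∘ Sum.inr)))
  refine h.trans (Eq.subst (motive := Sim m Γ _) ?_ (Sim.refl _))
  simp only [clebschMoment, sub_eq_add_neg, LinOp.app_add, LinOp.app_neg, pairing_add_left,
    pairing_add_right, pairing_neg_left, pairing_neg_right]
  ring

theorem sim_poisson_clebschB_skew (H F : FunVV m Γ R n) :
    Sim m Γ (poisson (clebschB χ O) H F) (-poisson (clebschB χ O) F H) :=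
  ((sim_poisson _ H F).trans (sim_pairing_clebschB χ O _ _)).trans
    ((O.skew _ _ _).trans ((sim_poisson _ F H).trans (sim_pairing_clebschB χ O _ _)).symm.neg)

/-- The skewsymmetry of X ↦ X˙u and that of 𝒪 are each used once, so the two signs cancel. -/
theorem sim_poisson_quadB (H F : FunDual m Γ R N) :
    Sim m Γ (poisson (quadB O) H F)
      (pairing (L.coad (varDer H) (uVec m Γ R N))
        (O.op.app (L.coad (varDer F) (uVec m Γ R N)))) := by
  refine (sim_poisson _ H F).trans ((sim_pairing_coad _ _ _).trans ?_)
  simpa using (O.skew _ (L.coad (varDer F) (uVec m Γ R N))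
    (L.coad (varDer H) (uVec m Γ R N))).neg

/-- The variation of Φ(H) in independent directions (δx, δp) is computed twice: directly, and
through u = x∇p as ⟨Y, δx∇p + x∇δp⟩ with Y = Φ(δH/δu). The latter is ∼ −⟨Y˙p, δx⟩ + ⟨Y.x, δp⟩;
comparing coefficients gives the gradient. -/
theorem varDer_clebschMap (H : FunDual m Γ R N) :
    varDer (clebschMap χ H) = Sum.elim
      (-χ.dual (clebschMap χ ∘ varDer H) (pVec m Γ R n))
      (χ.smul (clebschMap χ ∘ varDer H) (xVec m Γ R n)) := by
  have hc : IsDDMap m Γ (constHom m Γ R (FunVV m Γ R n) (Fin n ⊕ Fin n) :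
    FunVV m Γ R n →+ Jet m Γ (Fin n ⊕ Fin n) (FunVV m Γ R n)) := isDDMap_constHom
  have hD := isEvolution_gen (m := m) (Γ := Γ) (R := R) (κ := Fin n ⊕ Fin n)
  set c := constHom m Γ R (FunVV m Γ R n) (Fin n ⊕ Fin n)
  set D := (mkDerivation R fun v : (Fin n ⊕ Fin n) × Idx m Γ =>
      (Dop v.2 (gen v.1) : Jet m Γ (Fin n ⊕ Fin n) (FunVV m Γ R n))).toLinearMap
  set w := χ.nabla (xVec m Γ R n) (pVec m Γ R n)
  have hneg : ∀ {l : ℕ} (a : Fin l → FunVV m Γ R n), c ∘ (-a) = -(c ∘ a) :=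
    fun a => funext fun i => map_neg _ _
  have hcomp : IsDDMap m Γ (c.comp (jetHom w) :
      FunDual m Γ R N →+ Jet m Γ (Fin n ⊕ Fin n) (FunVV m Γ R n)) :=
    { map_der := fun l a => (congrArg c (jetHom_der w l a)).trans (hc.map_der l _)
      map_act := fun g a => (congrArg c (jetHom_act w g a)).trans (hc.map_act g _) }
  have h1 : Sim m Γ (D (clebschMap χ H)) (pairing (c ∘ varDer (clebschMap χ H)) gen) :=
    hD.sim_pairing_varDer hc _
  -- `D` after Φ is an evolution with velocity `D ∘ w`, so the first variation formula on Fun(𝒢^*)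
  -- applies to `H` itself.
  have h2 : Sim m Γ (D (clebschMap χ H)) (pairing (c ∘ (clebschMap χ ∘ varDer H)) (D ∘ w)) :=
    (hD.comp_jetHom hc w).sim_pairing_varDer hcomp H
  set Y := clebschMap χ ∘ varDer H
  have hgen : ∀ i, D (gen i) = gen i := fun i => hD.map_gen i
  have hDw : D ∘ w = χ.nabla (gen ∘ Sum.inl) (c ∘ pVec m Γ R n)
      + χ.nabla (c ∘ xVec m Γ R n) (gen ∘ Sum.inr) := by
    have h := χ.action.derivation_adjFst (hD.isDDDerivation hc) (xVec m Γ R n) (pVec m Γ R n)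
    rwa [show D ∘ xVec m Γ R n = gen ∘ Sum.inl from funext fun i => hgen _,
      show D ∘ pVec m Γ R n = gen ∘ Sum.inr from funext fun i => hgen _] at h
  refine eq_of_sim_pairing_gen (h1.symm.trans (h2.trans ?_))
  rw [hDw, pairing_add_right, pairing_sumElim]
  refine Sim.add ?_ ?_
  · rw [pairing_comm]
    refine (χ.sim_nabla _ _ _).trans ?_
    have h := (χ.sim_dual (c ∘ Y) (gen ∘ Sum.inl) (c ∘ pVec m Γ R n)).neg.symm
    rw [neg_neg, ← pairing_neg_left] at h
    convert h using 2
    change c ∘ (-χ.dual Y (pVec m Γ R n)) = _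
    rw [hneg]
    simp only [DDLieAlgebra.Rep.dual, hneg, BiOp.map_adjSnd _ hc]
  · rw [pairing_comm]
    refine (χ.sim_nabla _ _ _).trans ?_
    rw [pairing_comm]
    convert Sim.refl _ using 2
    exact (BiOp.map_app χ.action hc Y (xVec m Γ R n))

theorem clebschB_eq (M : Fin n ⊕ Fin n → FunVV m Γ R n) :
    clebschB χ O M = Sum.elim (χ.smul (O.op.app (-clebschMoment χ M)) (xVec m Γ R n))
      (χ.dual (O.op.app (-clebschMoment χ M)) (pVec m Γ R n)) := by
  have h : O.op.app (-clebschMoment χ M)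
      = -O.op.app (χ.nabla (xVec m Γ R n) (M ∘ Sum.inl))
        + O.op.app (χ.nabla (M ∘ Sum.inr) (pVec m Γ R n)) := by
    rw [clebschMoment, neg_sub, sub_eq_add_neg, LinOp.app_add, LinOp.app_neg, add_comm]
  rw [h, DDLieAlgebra.Rep.smul, DDLieAlgebra.Rep.dual, BiOp.app_add_left, BiOp.adjSnd_add_left,
    BiOp.app_neg_left, BiOp.adjSnd_neg_left, neg_add]
  rfl

theorem clebschMoment_varDer_clebschMap (H : FunDual m Γ R N) :
    clebschMoment χ (varDer (clebschMap χ H))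
      = -L.coad (clebschMap χ ∘ varDer H) (χ.nabla (xVec m Γ R n) (pVec m Γ R n)) := by
  rw [varDer_clebschMap, coad_nabla, clebschMoment, Sum.elim_comp_inl, Sum.elim_comp_inr, neg_add,
    DDLieAlgebra.Rep.nabla, BiOp.adjFst_neg_right, sub_eq_add_neg, add_comm]
  rfl

theorem clebschMap_comp_uVec :
    clebschMap χ ∘ uVec m Γ R N = χ.nabla (xVec m Γ R n) (pVec m Γ R n) := by
  unfold clebschMap uVec
  funext i
  rw [Function.comp_apply, jetHom_gen]

/-- Every operator in `quadB` has coefficients in `R`, so Φ passes through and only replaces u by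
x∇p. -/
theorem clebschMap_comp_quadB (Y : Fin N → FunDual m Γ R N) :
    clebschMap χ ∘ quadB O Y = L.coad (O.op.app (L.coad (clebschMap χ ∘ Y)
      (χ.nabla (xVec m Γ R n) (pVec m Γ R n)))) (χ.nabla (xVec m Γ R n) (pVec m Γ R n)) := by
  have hΦ : IsDDMap m Γ (clebschMap χ : FunDual m Γ R N →+ FunVV m Γ R n) :=
    isDDMap_jetHom (χ.nabla (xVec m Γ R n) (pVec m Γ R n))
  unfold quadB
  rw [DDLieAlgebra.map_coad hΦ, LinOp.map_app _ hΦ, DDLieAlgebra.map_coad hΦ,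
    clebschMap_comp_uVec]

theorem evol_comp_nabla (ξ η : Fin n → FunVV m Γ R n) :
    (evol (Sum.elim ξ η)).toLinearMap ∘ χ.nabla (xVec m Γ R n) (pVec m Γ R n)
      = χ.nabla ξ (pVec m Γ R n) + χ.nabla (xVec m Γ R n) η := by
  have hD := isEvolution_evol (m := m) (Γ := Γ) (R := R) (Sum.elim ξ η)
  have h := χ.action.derivation_adjFst (hD.isDDDerivation isDDMap_id)
    (xVec m Γ R n) (pVec m Γ R n)
  rwa [show (evol (Sum.elim ξ η)).toLinearMap ∘ xVec m Γ R n = ξ from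
      funext fun i => hD.map_gen _,
    show (evol (Sum.elim ξ η)).toLinearMap ∘ pVec m Γ R n = η from
      funext fun i => hD.map_gen _] at h

theorem isHamiltonian_clebschMap : IsHamiltonian (clebschMap χ) (quadB O) (clebschB χ O) := by
  intro H F
  have h1 := (isDDMap_jetHom (χ.nabla (xVec m Γ R n) (pVec m Γ R n))).comp_evol
    (quadB O (varDer H))
  have h2 := (isEvolution_evol (clebschB χ O (varDer (clebschMap χ H)))).comp_jetHom isDDMap_id
    (χ.nabla (xVec m Γ R n) (pVec m Γ R n))
  -- With Z = 𝒪(Y˙(x∇p)), Y = Φ(δH/δu), the two velocities are Z˙(x∇p) and (Z.x)∇p + x∇(Z˙p), equal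
  -- by equivariance.
  have e : clebschMap χ ∘ quadB O (varDer H)
      = (evol (clebschB χ O (varDer (clebschMap χ H)))).toLinearMap
        ∘ χ.nabla (xVec m Γ R n) (pVec m Γ R n) := by
    rw [clebschMap_comp_quadB, clebschB_eq, clebschMoment_varDer_clebschMap, neg_neg,
      evol_comp_nabla, coad_nabla]
  rw [← e] at h2
  exact LinearMap.congr_fun (h1.unique h2) F

end Main

end Clebsch

end

theorem mainTheorem5 {m : ℕ} {Γ : Type u} [Group Γ] {R : Type u} [CommRing R]
    [DDRing m Γ R] {N n : ℕ} (L : DDLieAlgebra m Γ R N)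
    (O : L.OOperator) (χ : L.Rep n) :
    -- the quadratic bracket on the dual of the Lie algebra
    (∀ H F : FunDual m Γ R N,
      Sim m Γ (poisson (quadB O) H F)
        (pairing (L.coad (varDer H) (uVec m Γ R N))
          (O.op.app (L.coad (varDer F) (uVec m Γ R N))))) ∧
    -- the bracket on `V ⊕ V^*` defined by the matrix `B`, and its skewsymmetry
    (∀ H F : FunVV m Γ R n,
      Sim m Γ (poisson (clebschB χ O) H F)
          (pairing (varDer F) (clebschB χ O (varDer H))) ∧
        Sim m Γ (poisson (clebschB χ O) H F)
          (-poisson (clebschB χ O) F H)) ∧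
    -- the formulae for the four blocks of `B`
    (∀ M M' : Fin n → FunVV m Γ R n,
      Sim m Γ (pairing M' (Bxx χ O M))
          (pairing (χ.nabla (xVec m Γ R n) M)
            (O.op.app (χ.nabla (xVec m Γ R n) M'))) ∧
        Sim m Γ (pairing M' (Bxp χ O M))
          (-pairing (χ.nabla M (pVec m Γ R n))
            (O.op.app (χ.nabla (xVec m Γ R n) M'))) ∧
        Sim m Γ (pairing M' (Bpx χ O M))
          (-pairing (χ.nabla (xVec m Γ R n) M)
            (O.op.app (χ.nabla M' (pVec m Γ R n)))) ∧
        Sim m Γ (pairing M' (Bpp χ O M))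
          (pairing (χ.nabla M (pVec m Γ R n))
            (O.op.app (χ.nabla M' (pVec m Γ R n))))) ∧
    -- the Clebsch map is Hamiltonian
    IsHamiltonian (clebschMap χ) (quadB O) (clebschB χ O) := by
  exact ⟨sim_poisson_quadB O,
    fun H F => ⟨sim_poisson _ H F, sim_poisson_clebschB_skew χ O H F⟩,
    fun M M' => ⟨sim_pairing_Bxx χ O M M', sim_pairing_Bxp χ O M M', sim_pairing_Bpx χ O M M',
      sim_pairing_Bpp χ O M M'⟩,
    isHamiltonian_clebschMap χ O⟩
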